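/- All graphs are finite and simple. For a graph $G=(V,E)$, let $\mu(G)=2|E|/|V|$ denote its average degree. Let $\bar E=\{(u,v)\in V^2 : u\sim_G v\}$ be the set of arcs of $G$, and let $B(G)\in\{0,1\}^{\bar E\times\bar E}$ be the matrix with $B(G)_{(u,v),(u',v')}=1$ if and only if $u'=v$ and $u\neq v'$. For $G$ connected with minimum degree at least $2$, let $\lambda_*(B(G))$ be the Perron--Frobenius eigenvalue of $B(G)$, that is, the largest absolute value of a complex eigenvalue of $B(G)$. For real $\mu\ge 2$ and integers $n\ge\mu+1$, let $\lambda_*(\mu;n)$ be the infimum of $\lambda_*(B(G))$ over all connected graphs $G$ with $|V(G)|=n$, minimum degree at least $2$ and average degree at least $\mu$, and let \[\lambda_*(\mu)=\liminf_{n\to\infty}\lambda_*(\mu;n).\] For $0<p,\beta<1$ let \[D(\beta\Vert p)=\beta\ln\Bigl(\frac{\beta}{p}\Bigr)+(1-\beta)\ln\Bigl(\frac{1-\beta}{1-p}\Bigr),\] and let $f_p^{\beta}(G)$ be the probability that a random set $X\subseteq E$, containing each edge of $G$ independently with probability $p$, satisfies $|X\cap E(C)|\ge\beta|E(C)|$ for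 some circuit $C$ of $G$ (a circuit is a connected $2$-regular subgraph). \textbf{Theorem.} Let $\mu_0\ge 2$ and $0<p<\beta<1$ be real numbers satisfying $\exp(D(\beta\Vert p))<\lambda_*(\mu_0)$. Then there exists $\delta=\delta(\mu_0,p,\beta)>0$ such that every connected graph $G$ with $\mu(G)\ge\mu_0$ satisfies $f_p^{\beta}(G)\ge\delta$. -/

import Mathlib

namespace CycleCode

section Graphs

variable {V : Type*} [Fintype V]

open Classical in
/-- The average degree `μ(G)` of a finite graph `G`. -/
noncomputable def avgDegree (G : SimpleGraph V) : ℝ :=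
  (∑ v : V, (G.degree v : ℝ)) / (Fintype.card V : ℝ)

open Classical in
/-- The non-backtracking matrix `B(G)`, indexed by the arcs of `G`: the entry at
`(u, v), (u', v')` is `1` if `u' = v` and `u ≠ v'`, and `0` otherwise. -/
noncomputable def nonBacktrackingMatrix (G : SimpleGraph V) : Matrix G.Dart G.Dart ℝ :=
  Matrix.of fun e f => if f.fst = e.snd ∧ e.fst ≠ f.snd then 1 else 0

open Classical in
/-- `λ_*(B(G))`: the largest absolute value of a complex eigenvalue of the non-backtracking
matrix, which is its Perron-Frobenius eigenvalue when `G` is connected with minimum degree at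
least two. -/
noncomputable def nonBacktrackingRadius (G : SimpleGraph V) : ℝ :=
  (spectralRadius ℂ ((nonBacktrackingMatrix G).map (fun x : ℝ => (x : ℂ)))).toReal

open Classical in
/-- Membership in the class of connected finite graphs with average degree at least `μ` and
minimum degree at least `2`. -/
def InClass (μ : ℝ) (G : SimpleGraph V) : Prop :=
  G.Connected ∧ μ ≤ avgDegree G ∧ ∀ v : V, 2 ≤ G.degree v

/-- `X` contains at least a `β`-fraction of the edges of some circuit of `G`. A circuit is a
connected 2-regular subgraph, given here by a closed walk tracing it; the number of its edges is
the length of this walk. -/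
def ContainsFractionOfCircuit (G : SimpleGraph V) (β : ℝ) (X : Set (Sym2 V)) : Prop :=
  ∃ (v : V) (c : G.Walk v v), c.IsCycle ∧
    β * (c.length : ℝ) ≤ ((X ∩ {e | e ∈ c.edges}).ncard : ℝ)

/-- `f_p^β(G)`: the probability that a `p`-random subset of the edge set of `G` contains at least
a `β`-fraction of the edges of some circuit of `G`. -/
noncomputable def circuitProb (p : unitInterval) (β : ℝ) (G : SimpleGraph V) : ℝ :=
  (ProbabilityTheory.setBernoulli G.edgeSet p).real {X | ContainsFractionOfCircuit G β X}

end Graphs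

/-- `λ_*(μ; n)`: the infimum of `λ_*(B(G))` over the graphs `G` on `n` vertices in the class of
connected graphs with average degree at least `μ` and minimum degree at least `2`. -/
noncomputable def lambdaStarAt (μ : ℝ) (n : ℕ) : ℝ :=
  sInf {x : ℝ | ∃ G : SimpleGraph (Fin n), InClass μ G ∧ nonBacktrackingRadius G = x}

/-- `λ_*(μ)`, the lower limit of `λ_*(μ; n)` as `n` tends to infinity. -/
noncomputable def lambdaStar (μ : ℝ) : ℝ :=
  Filter.liminf (fun n : ℕ => lambdaStarAt μ n) Filter.atTop

/-- The relative entropy `D(α ‖ p)`, for `α` and `p` in the open unit interval. -/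
noncomputable def relEntropy (α p : ℝ) : ℝ :=
  α * Real.log (α / p) + (1 - α) * Real.log ((1 - α) / (1 - p))

end CycleCode

/-! If `G` has a circuit of bounded length, all its edges are in `X` with probability bounded below.
Otherwise the girth is large. Explore `G` from one arc without backtracking, revealing edges one by
one and abandoning a path once its hits fall behind a fraction `b` slightly above `β`. A path of
length `n` survives with probability about `exp (-n D)`, and the number of paths grows like the
`n`-th power of the nonbacktracking radius, so the exploration behaves like a supercritical
branching process. As `G` is finite, it cannot go on through new vertices forever: unless it dies
out, it meets a vertex already reached and closes a circuit. On this circuit the fraction of hits is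
`b` up to a bounded number of edges, which the girth absorbs.

Two potentials make this uniform in `G`. `exists_scoreProcess` gives a finite automaton with a
weight on its states that loses at most a factor `l` per edge in expectation, and `exists_isGrowing`
gives a function `y` on the arcs that gains a factor `l₁ > l`. Their product controls extinction:
`one_sub_prod_le_revealProb` proves this by induction on the number of unrevealed edges. The
resulting bound depends on `S` and `ε` only, because `y` has maximum `1`.

The radius is bounded below only for large graphs of minimum degree at least `2`. Deleting leaves
(`exists_core`) leads to such a graph, and it is large because it contains a circuit. -/

namespace CycleCode

/-! ### Revealing a random set one element at a time -/

section Reveal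

open Classical in
/-- The probability that `F (Y ∪ Z)` holds for a `p`-random subset `Z` of `A`. -/
noncomputable def revealProb {α : Type*} (p : ℝ) (F : Set α → Prop) (A Y : Finset α) : ℝ :=
  ∑ Z ∈ A.powerset, p ^ Z.card * (1 - p) ^ (A.card - Z.card) *
    if F ((Y : Set α) ∪ Z) then 1 else 0

variable {α : Type*} {p : ℝ} {F : Set α → Prop}

lemma revealProb_nonneg (hp₀ : 0 ≤ p) (hp₁ : p ≤ 1) (A Y : Finset α) :
    0 ≤ revealProb p F A Y := by
  refine Finset.sum_nonneg fun Z _ => ?_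
  have : 0 ≤ 1 - p := by linarith
  split_ifs <;> positivity

lemma revealProb_eq_one (hF : ∀ s t : Set α, s ⊆ t → F s → F t) (A : Finset α) {Y : Finset α}
    (hY : F Y) : revealProb p F A Y = 1 := by
  classical
  have h : revealProb p F A Y = ∑ Z ∈ A.powerset, p ^ Z.card * (1 - p) ^ (A.card - Z.card) := by
    refine Finset.sum_congr rfl fun Z _ => ?_
    rw [if_pos, mul_one]
    exact hF _ _ (by simp) hY
  rw [h, Finset.sum_pow_mul_eq_add_pow]
  simp

lemma revealProb_insert [DecidableEq α] {A : Finset α} {e : α} (he : e ∉ A) (Y : Finset α) :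
    revealProb p F (insert e A) Y =
      p * revealProb p F A (insert e Y) + (1 - p) * revealProb p F A Y := by
  classical
  unfold revealProb
  rw [Finset.sum_powerset_insert he, add_comm, Finset.mul_sum, Finset.mul_sum]
  congr 1
  · refine Finset.sum_congr rfl fun Z hZ => ?_
    have hZA := Finset.mem_powerset.1 hZ
    have heZ : e ∉ Z := fun h => he (hZA h)
    rw [Finset.card_insert_of_notMem heZ, Finset.card_insert_of_notMem he,
      Nat.add_sub_add_right, pow_succ]
    have : (Y : Set α) ∪ ((insert e Z : Finset α) : Set α) =
        ((insert e Y : Finset α) : Set α) ∪ Z := by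
      simp [Set.union_insert, Set.insert_union]
    rw [this]
    ring
  · refine Finset.sum_congr rfl fun Z hZ => ?_
    have hZA := Finset.card_le_card (Finset.mem_powerset.1 hZ)
    rw [Finset.card_insert_of_notMem he, Nat.succ_sub hZA, pow_succ]
    ring

/-- Conditioning on whether `e` belongs to the random set; the exploration uses this once per
revealed edge. -/
lemma revealProb_erase [DecidableEq α] {A : Finset α} {e : α} (he : e ∈ A) (Y : Finset α) :
    revealProb p F A Y =
      p * revealProb p F (A.erase e) (insert e Y) + (1 - p) * revealProb p F (A.erase e) Y := by
  conv_lhs => rw [← Finset.insert_erase he]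
  exact revealProb_insert (Finset.notMem_erase e A) Y

lemma pow_card_le_revealProb [DecidableEq α] (hp₀ : 0 ≤ p) (hp₁ : p ≤ 1)
    (hF : ∀ s t : Set α, s ⊆ t → F s → F t) (C : Finset α) :
    ∀ A Y : Finset α, C ⊆ A → F ((C : Set α) ∪ Y) →
      p ^ C.card ≤ revealProb p F A Y := by
  induction C using Finset.induction_on with
  | empty => intro A Y _ h; rw [revealProb_eq_one hF A (by simpa using h)]; simp
  | insert e C he ih =>
    intro A Y hCA h
    rw [revealProb_erase (hCA (Finset.mem_insert_self e C)), Finset.card_insert_of_notMem he,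
      pow_succ']
    have h₁ := ih (A.erase e) (insert e Y)
      (fun x hx => Finset.mem_erase.2
        ⟨fun h => he (h ▸ hx), hCA (Finset.mem_insert_of_mem hx)⟩)
      (by simpa [Set.union_insert, Set.insert_union] using h)
    have h₂ : 0 ≤ (1 - p) * revealProb p F (A.erase e) Y :=
      mul_nonneg (by linarith) (revealProb_nonneg hp₀ hp₁ _ _)
    nlinarith [mul_le_mul_of_nonneg_left h₁ hp₀]

end Reveal

/-! ### The circuit probability as a finite sum -/

section Circuits

variable {V : Type*}

lemma ContainsFractionOfCircuit.mono [Fintype V] {G : SimpleGraph V} {β : ℝ} {s t : Set (Sym2 V)}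
    (hst : s ⊆ t) (h : ContainsFractionOfCircuit G β s) : ContainsFractionOfCircuit G β t := by
  obtain ⟨v, c, hc, hle⟩ := h
  refine ⟨v, c, hc, hle.trans ?_⟩
  exact_mod_cast Set.ncard_le_ncard (Set.inter_subset_inter_left _ hst) (Set.toFinite _)

open Classical in
lemma circuitProb_eq_revealProb [Fintype V] (p : unitInterval) (β : ℝ) (G : SimpleGraph V) :
    circuitProb p β G =
      revealProb (p : ℝ) (ContainsFractionOfCircuit G β) G.edgeFinset ∅ := by
  unfold circuitProb revealProb
  rw [MeasureTheory.measureReal_def, ProbabilityTheory.setBernoulli_apply_eq_apply_subsets,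
    ← MeasureTheory.measureReal_def]
  have hset : {s | s ∈ {X | ContainsFractionOfCircuit G β X} ∧ s ⊆ G.edgeSet} =
      ⋃ Z ∈ G.edgeFinset.powerset.filter
        (fun Z : Finset (Sym2 V) => ContainsFractionOfCircuit G β Z), {(Z : Set (Sym2 V))} := by
    ext s
    simp only [Set.mem_ofPred_eq, Set.mem_iUnion, Finset.mem_filter, Finset.mem_powerset,
      Set.mem_singleton_iff, exists_prop]
    constructor
    · rintro ⟨h₁, h₂⟩
      refine ⟨s.toFinset, ⟨?_, by simpa using h₁⟩, by simp⟩
      intro x hx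
      simpa using h₂ (by simpa using hx)
    · rintro ⟨Z, ⟨h₁, h₂⟩, rfl⟩
      refine ⟨h₂, fun x hx => ?_⟩
      simpa using h₁ hx
  rw [hset, MeasureTheory.measureReal_biUnion_finset, Finset.sum_filter]
  · refine Finset.sum_congr rfl fun Z hZ => ?_
    have hsub : (Z : Set (Sym2 V)) ⊆ G.edgeSet := by
      simpa using Finset.coe_subset.2 (Finset.mem_powerset.1 hZ)
    rw [Finset.coe_empty, Set.empty_union]
    split_ifs
    · rw [ProbabilityTheory.setBernoulli_real_singleton p hsub (Set.toFinite _),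
        Set.ncard_sdiff' hsub (Set.toFinite _), Set.ncard_coe_finset, mul_one,
        ← SimpleGraph.coe_edgeFinset, Set.ncard_coe_finset]
    · simp
  · intro a _ b _ hab
    simpa [Function.onFun] using hab
  · intro a _
    exact MeasurableSet.singleton _

end Circuits

/-! ### Binomial lower bound with the relative entropy as exponent -/

section Binomial

/-- The mode of the binomial distribution with `K + M` trials and mean `K` is `K`. -/
lemma choose_mul_pow_mul_pow_le (K M : ℕ) : ∀ j ≤ K + M,
    (K + M).choose j * K ^ j * M ^ (K + M - j) ≤ (K + M).choose K * K ^ K * M ^ M := by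
  -- The ratio of consecutive terms, cleared of denominators. It is at least `1` below `K` and at
  -- most `1` from `K` on.
  have hstep : ∀ j < K + M, (K + M).choose (j + 1) * K ^ (j + 1) * M ^ (K + M - (j + 1)) * (j + 1) *
      M = (K + M).choose j * K ^ j * M ^ (K + M - j) * ((K + M - j) * K) := by
    intro j hj
    have h := Nat.choose_succ_right_eq (K + M) j
    obtain ⟨d, hd⟩ : ∃ d, K + M - j = d + 1 := ⟨K + M - j - 1, by omega⟩
    have hd' : K + M - (j + 1) = d := by omega
    rw [hd] at h ⊢
    rw [hd']
    calc _ = ((K + M).choose (j + 1) * (j + 1)) * K ^ (j + 1) * M ^ d * M := by ring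
      _ = _ := by rw [h]; ring
  have hup : ∀ n, K + n ≤ K + M →
      (K + M).choose (K + n) * K ^ (K + n) * M ^ (K + M - (K + n)) ≤
        (K + M).choose K * K ^ K * M ^ M := by
    intro n
    induction n with
    | zero => intro _; simp
    | succ n ih =>
      intro hn
      refine le_trans ?_ (ih (by omega))
      have h := hstep (K + n) (by omega)
      have hM : 0 < M := by omega
      refine Nat.le_of_mul_le_mul_right (c := (K + n + 1) * M) ?_ (by positivity)
      rw [← mul_assoc]
      refine (h.trans_le ?_)
      refine Nat.mul_le_mul_left _ ?_
      rw [mul_comm]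
      exact Nat.mul_le_mul (by omega) (by omega)
  have hdown : ∀ n ≤ K,
      (K + M).choose (K - n) * K ^ (K - n) * M ^ (K + M - (K - n)) ≤
        (K + M).choose K * K ^ K * M ^ M := by
    intro n
    induction n with
    | zero => intro _; simp
    | succ n ih =>
      intro hn
      refine le_trans ?_ (ih (by omega))
      have h := hstep (K - (n + 1)) (by omega)
      have he : K - (n + 1) + 1 = K - n := by omega
      rw [he] at h
      refine Nat.le_of_mul_le_mul_right (c := (K + M - (K - (n + 1))) * K) ?_
        (Nat.mul_pos (by omega) (by omega))
      rw [← h, mul_assoc]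
      refine Nat.mul_le_mul_left _ ?_
      rw [mul_comm]
      exact Nat.mul_le_mul (by omega) (by omega)
  intro j hj
  rcases le_total j K with h | h
  · have := hdown (K - j) (by omega)
    rwa [Nat.sub_sub_self h] at this
  · obtain ⟨n, rfl⟩ := Nat.exists_eq_add_of_le h
    exact hup n hj

/-- The binomial expansion has `K + M + 1` terms, none above the one at the mode. -/
lemma add_pow_le_choose_mul (K M : ℕ) :
    (K + M) ^ (K + M) ≤ (K + M + 1) * ((K + M).choose K * K ^ K * M ^ M) := by
  rw [add_pow]
  calc ∑ j ∈ Finset.range (K + M + 1), K ^ j * M ^ (K + M - j) * (K + M).choose j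
      ≤ ∑ j ∈ Finset.range (K + M + 1), (K + M).choose K * K ^ K * M ^ M := by
        refine Finset.sum_le_sum fun j hj => ?_
        have := choose_mul_pow_mul_pow_le K M j (by simpa [Nat.lt_succ_iff] using hj)
        calc _ = (K + M).choose j * K ^ j * M ^ (K + M - j) := by ring
          _ ≤ _ := this
    _ = _ := by simp

/-- Up to a factor linear in `t`, the quantity to be bounded is the `t`-th power of the left-hand
number in `hρ`, and an exponential beats a linear factor. -/
lemma exists_one_le_binomial {l p : ℝ} (hl : 0 < l) (hp₀ : 0 < p) (hp₁ : p < 1) {k j : ℕ}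
    (hk : 0 < k) (hj : 0 < j)
    (hρ : 1 < l ^ (k + j) * ((p * (k + j) / k) ^ k * ((1 - p) * (k + j) / j) ^ j)) :
    ∃ t : ℕ, 0 < t ∧ 1 ≤ l ^ ((k + j) * t) *
      ((((k + j) * t).choose (k * t) : ℝ) * p ^ (k * t) * (1 - p) ^ (j * t)) := by
  set ρ := l ^ (k + j) * ((p * (k + j) / k) ^ k * ((1 - p) * (k + j) / j) ^ j) with hρdef
  have hlim := (tendsto_pow_const_div_const_pow_of_one_lt 1 hρ).const_mul ((k : ℝ) + j + 1)
  rw [mul_zero] at hlim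
  obtain ⟨t, ht, ht₀⟩ := ((hlim.eventually_lt_const one_pos).and
    (Filter.eventually_gt_atTop 0)).exists
  refine ⟨t, ht₀, ?_⟩
  have hρt : 0 < ρ ^ t := by positivity
  have hq : 0 < 1 - p := by linarith
  have ht₁ : (1 : ℝ) ≤ t := by exact_mod_cast ht₀
  rw [pow_one, ← mul_div_assoc, div_lt_one hρt] at ht
  have hk' : (0 : ℝ) < k := by exact_mod_cast hk
  have hj' : (0 : ℝ) < j := by exact_mod_cast hj
  have ht' : (0 : ℝ) < t := by exact_mod_cast ht₀
  have hmode := add_pow_le_choose_mul (k * t) (j * t)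
  rw [← add_mul] at hmode
  have hmode' : (((k : ℝ) + j) * t) ^ ((k + j) * t) ≤ (((k : ℝ) + j) * t + 1) *
      ((((k + j) * t).choose (k * t) : ℝ) * (k * t) ^ (k * t) * (j * t) ^ (j * t)) := by
    exact_mod_cast hmode
  set C : ℝ := (((k + j) * t).choose (k * t) : ℝ) with hC
  have hfac : (0 : ℝ) < (k * t : ℝ) ^ (k * t) * (j * t : ℝ) ^ (j * t) := by positivity
  have hid : ρ ^ t * ((k * t : ℝ) ^ (k * t) * (j * t : ℝ) ^ (j * t)) =
      l ^ ((k + j) * t) * (p ^ (k * t) * (1 - p) ^ (j * t)) *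
        (((k : ℝ) + j) * t) ^ ((k + j) * t) := by
    rw [hρdef]
    simp only [mul_pow, div_pow, ← pow_mul, add_mul, pow_add]
    field_simp
    rw [mul_pow, mul_pow]
    ring
  have hA : 0 < l ^ ((k + j) * t) * (p ^ (k * t) * (1 - p) ^ (j * t)) := by positivity
  have hmain : ρ ^ t ≤ (((k : ℝ) + j) * t + 1) *
      (l ^ ((k + j) * t) * (C * p ^ (k * t) * (1 - p) ^ (j * t))) := by
    refine le_of_mul_le_mul_right ?_ hfac
    rw [hid]
    calc _ ≤ _ := mul_le_mul_of_nonneg_left hmode' hA.le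
      _ = _ := by ring
  have hpos : 0 < ((k : ℝ) + j) * t + 1 := by positivity
  have hle : ((k : ℝ) + j) * t + 1 ≤ ρ ^ t := by nlinarith
  by_contra hcon
  push Not at hcon
  nlinarith [mul_lt_mul_of_pos_left hcon hpos]

/-- By continuity `β` can be raised to a rational `q = k / (k + j)` with `exp (relEntropy q p) < l`.
The number in `exists_one_le_binomial` is then the `(k + j)`-th power of `l / exp (relEntropy q p)`.
-/
lemma exists_block {l p β : ℝ} (hp₀ : 0 < p) (hpβ : p < β) (hβ : β < 1)
    (hl : Real.exp (relEntropy β p) < l) :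
    ∃ L K : ℕ, 0 < L ∧ K ≤ L ∧ β < K / L ∧
      1 ≤ l ^ L * ((L.choose K : ℝ) * p ^ K * (1 - p) ^ (L - K)) := by
  have hβ₀ : 0 < β := hp₀.trans hpβ
  have hp₁ : p < 1 := hpβ.trans hβ
  have hl₀ : 0 < l := (Real.exp_pos _).trans hl
  have hcont : ContinuousAt (fun b => Real.exp (relEntropy b p)) β := by
    unfold relEntropy
    have h₁ : β / p ≠ 0 := by positivity
    have h₂ : (1 - β) / (1 - p) ≠ 0 := (div_pos (by linarith) (by linarith)).ne'
    fun_prop (disch := assumption)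
  have hmem : {b | Real.exp (relEntropy b p) < l} ∩ Set.Ioo β 1 ∈ nhdsWithin β (Set.Ioi β) :=
    Filter.inter_mem (nhdsWithin_le_nhds (hcont.eventually_lt_const hl)) (Ioo_mem_nhdsGT hβ)
  obtain ⟨u, hu, hsub⟩ := mem_nhdsGT_iff_exists_Ioo_subset.1 hmem
  obtain ⟨q, hq₁, hq₂⟩ := exists_rat_btwn (show β < u from hu)
  obtain ⟨hqD, -, hq1⟩ := hsub ⟨hq₁, hq₂⟩
  have hq0 : (0 : ℝ) < q := hβ₀.trans hq₁
  have hq0' : 0 < q := by exact_mod_cast hq0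
  have hq1' : q < 1 := by exact_mod_cast hq1
  obtain ⟨k, hk⟩ := Int.eq_ofNat_of_zero_le (Rat.num_pos.2 hq0').le
  have hqk : q = (k : ℚ) / q.den := by
    conv_lhs => rw [← Rat.num_div_den q, hk]
    simp
  have hden : (0 : ℚ) < q.den := by exact_mod_cast q.den_pos
  have hk0 : 0 < k := by
    have := Rat.num_pos.2 hq0'
    omega
  have hkden : k < q.den := by
    rw [hqk, div_lt_one hden] at hq1'
    exact_mod_cast hq1'
  obtain ⟨j, hj⟩ : ∃ j, q.den = k + j := ⟨q.den - k, by omega⟩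
  have hj0 : 0 < j := by omega
  have hqR : (q : ℝ) = (k : ℝ) / ((k : ℝ) + j) := by
    have h := congrArg (fun x : ℚ => (x : ℝ)) hqk
    rw [h, hj]
    push_cast
    ring
  have hk' : (0 : ℝ) < k := by exact_mod_cast hk0
  have hj' : (0 : ℝ) < j := by exact_mod_cast hj0
  have hexp : Real.exp (relEntropy q p) ^ (k + j) *
      ((p * (k + j) / k) ^ k * ((1 - p) * (k + j) / j) ^ j) = 1 := by
    have hq' : 0 < 1 - p := by linarith
    have h1q : (1 - (q : ℝ)) = (j : ℝ) / ((k : ℝ) + j) := by rw [hqR]; field_simp; ring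
    have e₁ : p * (k + j) / k = ((q : ℝ) / p)⁻¹ := by rw [hqR]; field_simp
    have e₂ : (1 - p) * (k + j) / j = ((1 - (q : ℝ)) / (1 - p))⁻¹ := by rw [h1q]; field_simp
    have p₁ : 0 < (q : ℝ) / p := by positivity
    have p₂ : 0 < (1 - (q : ℝ)) / (1 - p) := div_pos (by linarith) hq'
    have e₃ : Real.exp (relEntropy q p) ^ (k + j) =
        ((q : ℝ) / p) ^ k * ((1 - (q : ℝ)) / (1 - p)) ^ j := by
      rw [← Real.exp_nat_mul, relEntropy]
      have : ((k + j : ℕ) : ℝ) * (q * Real.log (q / p) +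
          (1 - q) * Real.log ((1 - q) / (1 - p))) =
          k * Real.log (q / p) + j * Real.log ((1 - q) / (1 - p)) := by
        rw [mul_add, ← mul_assoc, ← mul_assoc]
        congr 2
        · rw [hqR]; push_cast; field_simp
        · rw [h1q]; push_cast; field_simp
      rw [this, Real.exp_add, Real.exp_nat_mul, Real.exp_nat_mul, Real.exp_log p₁,
        Real.exp_log p₂]
    rw [e₁, e₂, e₃, inv_pow, inv_pow]
    have := pow_pos p₁ k
    have := pow_pos p₂ j
    field_simp
  have hρ : 1 < l ^ (k + j) * ((p * (k + j) / k) ^ k * ((1 - p) * (k + j) / j) ^ j) := by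
    have hq' : 0 < 1 - p := by linarith
    refine hexp.symm.trans_lt ?_
    refine mul_lt_mul_of_pos_right ?_ (by positivity)
    exact pow_lt_pow_left₀ hqD (Real.exp_pos _).le (by omega)
  obtain ⟨t, ht, hmain⟩ := exists_one_le_binomial hl₀ hp₀ hp₁ hk0 hj0 hρ
  refine ⟨(k + j) * t, k * t, by positivity, Nat.mul_le_mul_right _ (by omega), ?_, ?_⟩
  · have ht' : (t : ℝ) ≠ 0 := by exact_mod_cast ht.ne'
    push_cast
    rw [mul_div_mul_right _ _ ht', ← hqR]
    exact hq₁
  · have : (k + j) * t - k * t = j * t := by rw [add_mul]; omega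
    rw [this]
    exact hmain

end Binomial

/-! ### The automaton that scores paths in blocks -/

section ScoreProcess

/-- `l ^ r` times the probability that at least `k` out of `r` Bernoulli trials succeed. -/
noncomputable def survivalWeight (l p : ℝ) : ℕ → ℕ → ℝ
  | 0, 0 => 1
  | 0, _ + 1 => 0
  | r + 1, k => l * (p * survivalWeight l p r (k - 1) + (1 - p) * survivalWeight l p r k)

lemma le_survivalWeight {l p : ℝ} (hl : 0 ≤ l) (hp₀ : 0 ≤ p) (hp₁ : p ≤ 1) (r : ℕ) :
    ∀ k, l ^ r * ((r.choose k : ℝ) * p ^ k * (1 - p) ^ (r - k)) ≤ survivalWeight l p r k := by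
  have hq : 0 ≤ 1 - p := by linarith
  induction r with
  | zero =>
    intro k
    cases k <;> simp [survivalWeight]
  | succ r ih =>
    intro k
    rw [survivalWeight, pow_succ', mul_assoc]
    refine mul_le_mul_of_nonneg_left ?_ hl
    cases k with
    | zero =>
      have h := ih 0
      simp only [Nat.choose_zero_right, Nat.cast_one, pow_zero, mul_one, one_mul, Nat.sub_zero]  at h ⊢
      have h0 : 0 ≤ l ^ r * (1 - p) ^ r := by positivity
      rw [pow_succ]
      nlinarith [mul_nonneg hp₀ (h0.trans h), mul_le_mul_of_nonneg_left h hq]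
    | succ k =>
      have h₁ := mul_le_mul_of_nonneg_left (ih k) hp₀
      have h₂ := mul_le_mul_of_nonneg_left (ih (k + 1)) hq
      rw [Nat.choose_succ_succ, Nat.add_sub_add_right, Nat.add_sub_cancel]
      refine le_trans (le_of_eq ?_) (add_le_add h₁ h₂)
      rcases le_or_gt (k + 1) r with h | h
      · obtain ⟨d, hd⟩ : ∃ d, r - k = d + 1 := ⟨r - k - 1, by omega⟩
        rw [hd, show r - (k + 1) = d by omega]
        push_cast
        ring
      · rw [Nat.choose_eq_zero_of_lt h]
        push_cast
        ring

lemma survivalWeight_nonneg {l p : ℝ} (hl : 0 ≤ l) (hp₀ : 0 ≤ p) (hp₁ : p ≤ 1) (r k : ℕ) :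
    0 ≤ survivalWeight l p r k := by
  have hq : 0 ≤ 1 - p := by linarith
  exact le_trans (by positivity) (le_survivalWeight hl hp₀ hp₁ r k)

/-- A finite automaton reading the edges of a path one by one, each edge being a `hit` or a `miss`.
The function `gap` bounds from below by how much the number of hits falls short of a `b`-fraction,
and `weight` is a nonnegative function on the states whose expectation decreases by a factor of at
most `l` per edge. A path is abandoned when its weight vanishes. -/
structure ScoreProcess (p l b : ℝ) where
  State : Type
  init : State
  hit : State → State
  miss : State → State
  gap : State → ℝ
  weight : State → ℝ
  gapBound : ℝ
  weightBound : ℝ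
  abs_gap_le : ∀ s, |gap s| ≤ gapBound
  weight_nonneg : ∀ s, 0 ≤ weight s
  weight_le : ∀ s, weight s ≤ weightBound
  weight_init : 0 < weight init
  weight_le_step : ∀ s, weight s ≤ l * (p * weight (hit s) + (1 - p) * weight (miss s))
  gap_hit : ∀ s, 0 < weight s → gap s - (1 - b) ≤ gap (hit s)
  gap_miss : ∀ s, 0 < weight s → gap s + b ≤ gap (miss s)

lemma exists_scoreProcess {l p β : ℝ} (hp₀ : 0 < p) (hpβ : p < β) (hβ : β < 1)
    (hl : Real.exp (relEntropy β p) < l) :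
    ∃ b : ℝ, β < b ∧ Nonempty (ScoreProcess p l b) := by
  obtain ⟨L, K, hL, hKL, hb, hone⟩ := exists_block hp₀ hpβ hβ hl
  have hl₀ : 0 ≤ l := ((Real.exp_pos _).trans hl).le
  have hp₁ : p ≤ 1 := (hpβ.trans hβ).le
  have hL' : (0 : ℝ) < L := by exact_mod_cast hL
  have hKL' : (K : ℝ) ≤ L := by exact_mod_cast hKL
  have hb₀ : 0 ≤ (K : ℝ) / L := by positivity
  have hbL : (K : ℝ) / L * L = K := by field_simp
  have hsw := survivalWeight_nonneg hl₀ hp₀.le hp₁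
  refine ⟨K / L, hb, ?_⟩
  generalize (K : ℝ) / L = b at *
  -- A state records the edges left in the current block of length `L` and the hits still needed out
  -- of `K`. A completed block restarts at `(L, K)`, which leaves the gap unchanged since `b * L =
  -- K`; a failed block `(0, k)`, `k > 0`, has weight `0`.
  let norm : Fin (L + 1) × Fin (K + 1) → Fin (L + 1) × Fin (K + 1) := fun s =>
    if (s.1 : ℕ) = 0 ∧ (s.2 : ℕ) = 0 then (Fin.last L, Fin.last K) else s
  let gap : Fin (L + 1) × Fin (K + 1) → ℝ := fun s => (s.2 : ℕ) - b * (s.1 : ℕ)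
  let weight : Fin (L + 1) × Fin (K + 1) → ℝ := fun s =>
    if (s.1 : ℕ) = 0 then 0 else survivalWeight l p s.1 s.2
  have hgap : ∀ s, gap (norm s) = gap s := by
    intro s
    simp only [norm, gap]
    split_ifs with h
    · simp [h.1, h.2, hbL]
    · rfl
  -- A restart replaces the weight `1` of a completed block by that of a fresh block, which is at
  -- least `1` by the choice of `L` and `K`.
  have hweight : ∀ s, survivalWeight l p s.1 s.2 ≤ weight (norm s) := by
    intro s
    simp only [norm, weight]
    split_ifs with h₁ h₂ h₂
    · simp at h₂; omega
    · rw [h₁.1, h₁.2]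
      simpa [survivalWeight] using hone.trans (le_survivalWeight hl₀ hp₀.le hp₁ L K)
    · rw [h₂]
      obtain ⟨k, hk⟩ := Nat.exists_eq_succ_of_ne_zero (fun h => h₁ ⟨h₂, h⟩)
      rw [hk]
      simp [survivalWeight]
    · exact le_rfl
  obtain ⟨H, hH⟩ := (Set.finite_range weight).bddAbove
  refine ⟨{
    State := Fin (L + 1) × Fin (K + 1)
    init := (Fin.last L, Fin.last K)
    hit := fun s => norm (⟨s.1 - 1, by omega⟩, ⟨s.2 - 1, by omega⟩)
    miss := fun s => norm (⟨s.1 - 1, by omega⟩, s.2)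
    gap := gap
    weight := weight
    gapBound := L
    weightBound := H
    abs_gap_le := ?_
    weight_nonneg := ?_
    weight_le := fun s => hH ⟨s, rfl⟩
    weight_init := ?_
    weight_le_step := ?_
    gap_hit := ?_
    gap_miss := ?_ }⟩
  · rintro ⟨⟨r, hr⟩, ⟨k, hk⟩⟩
    have hr' : (r : ℝ) ≤ L := by exact_mod_cast Nat.lt_succ_iff.1 hr
    have hk' : (k : ℝ) ≤ K := by exact_mod_cast Nat.lt_succ_iff.1 hk
    simp only [gap]
    rw [abs_le]
    have h₀ : (0 : ℝ) ≤ r := by positivity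
    have h₀' : (0 : ℝ) ≤ k := by positivity
    constructor <;> nlinarith
  · intro s
    simp only [weight]
    split_ifs
    exacts [le_rfl, hsw _ _]
  · simp only [weight, Fin.val_last]
    rw [if_neg (by omega)]
    exact lt_of_lt_of_le one_pos (hone.trans (le_survivalWeight hl₀ hp₀.le hp₁ L K))
  · rintro ⟨⟨r, hr⟩, ⟨k, hk⟩⟩
    have h₁ := hweight (⟨r - 1, by omega⟩, ⟨k - 1, by omega⟩)
    have h₂ := hweight (⟨r - 1, by omega⟩, ⟨k, hk⟩)
    have hq : 0 ≤ 1 - p := by linarith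
    refine le_trans ?_ (mul_le_mul_of_nonneg_left (add_le_add
      (mul_le_mul_of_nonneg_left h₁ hp₀.le) (mul_le_mul_of_nonneg_left h₂ hq)) hl₀)
    simp only [weight]
    split_ifs with h
    · have := hsw (r - 1) (k - 1)
      have := hsw (r - 1) k
      positivity
    · obtain ⟨r, rfl⟩ := Nat.exists_eq_succ_of_ne_zero h
      rfl
  · rintro ⟨⟨r, hr⟩, ⟨k, hk⟩⟩ hs
    rw [hgap]
    have hr0 : r ≠ 0 := by
      rintro rfl
      simp [weight] at hs
    obtain ⟨r, rfl⟩ := Nat.exists_eq_succ_of_ne_zero hr0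
    -- Truncated subtraction: a hit beyond the `K` needed in a block is not credited, whence an
    -- inequality.
    have hk1 : (k : ℝ) - 1 ≤ (k - 1 : ℕ) := by
      have : k ≤ (k - 1) + 1 := by omega
      have : (k : ℝ) ≤ (k - 1 : ℕ) + 1 := by exact_mod_cast this
      linarith
    simp only [gap, Nat.succ_eq_add_one, Nat.add_sub_cancel]
    push_cast
    linarith
  · rintro ⟨⟨r, hr⟩, ⟨k, hk⟩⟩ hs
    rw [hgap]
    have hr0 : r ≠ 0 := by
      rintro rfl
      simp [weight] at hs
    obtain ⟨r, rfl⟩ := Nat.exists_eq_succ_of_ne_zero hr0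
    simp only [gap, Nat.succ_eq_add_one, Nat.add_sub_cancel]
    push_cast
    linarith

end ScoreProcess

/-! ### Exploring the graph -/

section Exploration

variable {V : Type*}

open Classical in
/-- The arcs continuing the arc `d` without backtracking. -/
noncomputable def continuations [Fintype V] {G : SimpleGraph V} (d : G.Dart) : Finset G.Dart :=
  Finset.univ.filter fun f => f.fst = d.snd ∧ d.fst ≠ f.snd

open Classical in
/-- The number of edges of a walk that belong to `Y`. -/
noncomputable def hits {G : SimpleGraph V} (Y : Finset (Sym2 V)) {u v : V} (P : G.Walk u v) : ℕ :=
  P.edges.countP (· ∈ Y)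

lemma hits_mono {G : SimpleGraph V} {Y Y' : Finset (Sym2 V)} (h : Y ⊆ Y') {u v : V}
    (P : G.Walk u v) : hits Y P ≤ hits Y' P := by
  classical
  exact List.countP_mono_left fun e _ he => by simpa using h (by simpa using he)

lemma hits_reverse {G : SimpleGraph V} (Y : Finset (Sym2 V)) {u v : V} (P : G.Walk u v) :
    hits Y P.reverse = hits Y P := by
  simp [hits, List.countP_reverse]

/-- The closing edge counts towards the length but not as a hit, as it may be unrevealed. -/
lemma containsFractionOfCircuit_of_path [Fintype V] {G : SimpleGraph V} {β : ℝ}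
    {Y : Finset (Sym2 V)} {u v : V} (h : G.Adj u v) {P : G.Walk v u} (hP : P.IsPath)
    (he : s(u, v) ∉ P.edges) (hle : β * (P.length + 1) ≤ hits Y P) :
    ContainsFractionOfCircuit G β Y := by
  classical
  refine ⟨u, .cons h P, (SimpleGraph.Walk.cons_isCycle_iff P h).2 ⟨hP, he⟩, ?_⟩
  rw [SimpleGraph.Walk.length_cons]
  push_cast
  refine hle.trans ?_
  have hnd : (P.edges.filter (· ∈ Y)).Nodup := hP.isTrail.edges_nodup.filter _
  rw [hits, List.countP_eq_length_filter, ← List.toFinset_card_of_nodup hnd,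
    ← Set.ncard_coe_finset]
  refine Nat.cast_le.2 (Set.ncard_le_ncard ?_ (Set.toFinite _))
  intro e he'
  have he' : e ∈ P.edges ∧ e ∈ Y := by simpa using he'
  exact ⟨he'.2, by simp [he'.1]⟩

/-- The state of the exploration of `G`: the edges in `A` have not been revealed, `U` consists of
the vertices reached so far and carrying the states `σ`, and `N` of the arcs to be explored. -/
structure Explored (G : SimpleGraph V) {p l b : ℝ} (S : ScoreProcess p l b)
    (A Y : Finset (Sym2 V)) (U : Set V) (N : Finset G.Dart) (σ : V → S.State) : Prop where
  mem_of_revealed : ∀ e ∈ G.edgeSet, e ∉ A → ∀ x ∈ e, x ∈ U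
  fst_mem : ∀ d ∈ N, d.fst ∈ U
  edge_mem : ∀ d ∈ N, d.edge ∈ A
  weight_pos : ∀ d ∈ N, 0 < S.weight (σ d.fst)
  -- The path climbs from `u` to a common ancestor `w` and descends to `v`. Along a descent, `b`
  -- times the length minus the hits is at most the increase of the gap; the two gaps at `w` cost at
  -- most `2 * S.gapBound`.
  exists_path : ∀ u ∈ U, ∀ v ∈ U, ∃ P : G.Walk u v, P.IsPath ∧ (∀ e ∈ P.edges, e ∉ A) ∧
    (∀ x ∈ P.support, x ∈ U) ∧
    b * P.length - 2 * S.gapBound - S.gap (σ u) - S.gap (σ v) ≤ hits Y P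

variable {G : SimpleGraph V} {p l b : ℝ} {S : ScoreProcess p l b}

-- Reaching a new vertex extends the tree by a leaf. The condition `hs` treats a hit and a miss
-- together.
open Classical in
lemma Explored.step [Fintype V] {A Y Y' : Finset (Sym2 V)} {U : Set V} {N : Finset G.Dart}
    {σ : V → S.State} (h : Explored G S A Y U N σ) {d : G.Dart} (hd : d ∈ N) (hdU : d.snd ∉ U)
    (hY : Y ⊆ Y') (s : S.State)
    (hs : S.gap (σ d.fst) - ((if d.edge ∈ Y' then 1 else 0) - b) ≤ S.gap s) :
    Explored G S (A.erase d.edge) Y' (insert d.snd U)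
      (N.erase d ∪ if 0 < S.weight s then continuations d else ∅)
      (Function.update σ d.snd s) := by
  have hU : ∀ x ∈ U, x ≠ d.snd := fun x hx hxd => hdU (hxd ▸ hx)
  have hσ : ∀ x ∈ U, Function.update σ d.snd s x = σ x := fun x hx =>
    Function.update_of_ne (hU x hx) _ _
  have hchild : ∀ f, (f ∈ if 0 < S.weight s then continuations d else ∅) →
      0 < S.weight s ∧ f.fst = d.snd ∧ d.fst ≠ f.snd := by
    intro f hf
    split_ifs at hf with hw
    · exact ⟨hw, by simpa [continuations] using hf⟩
    · simp at hf
  have hfst := h.fst_mem d hd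
  have hedge := h.edge_mem d hd
  have hnew : ∀ z ∈ U, ∃ P : G.Walk d.snd z, P.IsPath ∧ (∀ e ∈ P.edges, e ∉ A.erase d.edge) ∧
      (∀ x ∈ P.support, x ∈ insert d.snd U) ∧
      b * P.length - 2 * S.gapBound - S.gap s - S.gap (σ z) ≤ hits Y' P := by
    intro z hz
    obtain ⟨P, hP, hPA, hPU, hle⟩ := h.exists_path d.fst hfst z hz
    refine ⟨.cons d.adj.symm P, ?_, ?_, ?_, ?_⟩
    · rw [SimpleGraph.Walk.cons_isPath_iff]
      exact ⟨hP, fun hmem => hdU (hPU _ hmem)⟩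
    · intro e he
      rw [SimpleGraph.Walk.edges_cons, List.mem_cons] at he
      rcases he with rfl | he
      · rw [Sym2.eq_swap]
        exact Finset.notMem_erase _ _
      · exact fun hmem => hPA e he (Finset.mem_of_mem_erase hmem)
    · intro x hx
      rw [SimpleGraph.Walk.support_cons, List.mem_cons] at hx
      rcases hx with rfl | hx
      · exact Set.mem_insert _ _
      · exact Set.mem_insert_of_mem _ (hPU x hx)
    · have hcount : (hits Y' (.cons d.adj.symm P) : ℝ) =
          hits Y' P + if d.edge ∈ Y' then 1 else 0 := by
        have hde : s(d.snd, d.fst) = d.edge := Sym2.eq_swap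
        simp only [hits, SimpleGraph.Walk.edges_cons, List.countP_cons, hde]
        push_cast
        simp
      have hmono : (hits Y P : ℝ) ≤ hits Y' P := by exact_mod_cast hits_mono hY P
      rw [hcount, SimpleGraph.Walk.length_cons]
      push_cast
      linarith
  refine ⟨?_, ?_, ?_, ?_, ?_⟩
  · intro e he heA x hx
    by_cases hed : e = d.edge
    · rw [hed] at hx
      have hx' : x ∈ s(d.fst, d.snd) := hx
      rcases Sym2.mem_iff.1 hx' with rfl | rfl
      · exact Set.mem_insert_of_mem _ hfst
      · exact Set.mem_insert _ _
    · exact Set.mem_insert_of_mem _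
        (h.mem_of_revealed e he (fun hm => heA (Finset.mem_erase.2 ⟨hed, hm⟩)) x hx)
  · intro f hf
    rcases Finset.mem_union.1 hf with hf | hf
    · exact Set.mem_insert_of_mem _ (h.fst_mem f (Finset.mem_of_mem_erase hf))
    · rw [(hchild f hf).2.1]
      exact Set.mem_insert _ _
  · intro f hf
    rw [Finset.mem_erase]
    rcases Finset.mem_union.1 hf with hf | hf
    · have hfN := Finset.mem_of_mem_erase hf
      -- Another arc of `N` with the same edge would be the reverse of `d`, starting at the
      -- unreached vertex `d.snd`.
      refine ⟨fun heq => ?_, h.edge_mem f hfN⟩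
      rcases SimpleGraph.dart_edge_eq_iff f d |>.1 heq with rfl | rfl
      · exact Finset.notMem_erase _ _ hf
      · exact hdU (h.fst_mem _ hfN)
    · obtain ⟨-, hf₁, hf₂⟩ := hchild f hf
      constructor
      · intro heq
        rcases SimpleGraph.dart_edge_eq_iff f d |>.1 heq with rfl | rfl
        · exact f.adj.ne hf₁
        · exact hf₂ rfl
      · by_contra hfA
        refine hdU (h.mem_of_revealed f.edge f.edge_mem hfA d.snd ?_)
        rw [← hf₁]
        exact Sym2.mem_mk_left _ _
  · intro f hf
    rcases Finset.mem_union.1 hf with hf | hf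
    · have hfN := Finset.mem_of_mem_erase hf
      rw [hσ _ (h.fst_mem f hfN)]
      exact h.weight_pos f hfN
    · obtain ⟨hw, hf₁, -⟩ := hchild f hf
      rw [hf₁, Function.update_self]
      exact hw
  · intro u hu v hv
    rcases hu with rfl | hu <;> rcases hv with rfl | hv
    · refine ⟨.nil, .nil, by simp, by simp, ?_⟩
      have := abs_le.1 (S.abs_gap_le s)
      simp only [SimpleGraph.Walk.length_nil, Function.update_self]
      have h0 : (0 : ℝ) ≤ hits Y' (SimpleGraph.Walk.nil : G.Walk d.snd d.snd) := by positivity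
      push_cast
      linarith
    · obtain ⟨P, hP, hPA, hPU, hle⟩ := hnew v hv
      rw [hσ v hv, Function.update_self]
      exact ⟨P, hP, hPA, hPU, hle⟩
    · obtain ⟨P, hP, hPA, hPU, hle⟩ := hnew u hu
      rw [hσ u hu, Function.update_self]
      refine ⟨P.reverse, hP.reverse, by simpa using hPA, by simpa using hPU, ?_⟩
      rw [hits_reverse, SimpleGraph.Walk.length_reverse]
      linarith
    · obtain ⟨P, hP, hPA, hPU, hle⟩ := h.exists_path u hu v hv
      rw [hσ u hu, hσ v hv]
      refine ⟨P, hP, fun e he hm => hPA e he (Finset.mem_of_mem_erase hm),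
        fun x hx => Set.mem_insert_of_mem _ (hPU x hx), hle.trans ?_⟩
      exact_mod_cast hits_mono hY P

/-- The tree path joining the ends of `d` consists of revealed edges, so it avoids `d.edge`. It
lacks at most `4 * S.gapBound` hits, and the closing edge costs a further `b`. -/
lemma Explored.containsFractionOfCircuit [Fintype V] {β : ℝ} {A Y : Finset (Sym2 V)} {U : Set V}
    {N : Finset G.Dart} {σ : V → S.State} (h : Explored G S A Y U N σ)
    (hgirth : ∀ (v : V) (c : G.Walk v v), c.IsCycle →
      4 * S.gapBound + b ≤ (b - β) * c.length)
    {d : G.Dart} (hd : d ∈ N) (hdU : d.snd ∈ U) : ContainsFractionOfCircuit G β Y := by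
  obtain ⟨P, hP, hPA, -, hle⟩ := h.exists_path d.snd hdU d.fst (h.fst_mem d hd)
  have he : s(d.fst, d.snd) ∉ P.edges := fun hm => hPA _ hm (h.edge_mem d hd)
  refine containsFractionOfCircuit_of_path d.adj hP he ?_
  have hc := hgirth _ (.cons d.adj P) ((SimpleGraph.Walk.cons_isCycle_iff P d.adj).2 ⟨hP, he⟩)
  rw [SimpleGraph.Walk.length_cons] at hc
  push_cast at hc
  have h₁ := abs_le.1 (S.abs_gap_le (σ d.fst))
  have h₂ := abs_le.1 (S.abs_gap_le (σ d.snd))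
  linarith

/-- The probability that none of the arcs in `N` leads to a circuit is at most
`∏ d ∈ N, (1 - c * y d * S.weight (σ d.fst))`. -/
lemma one_sub_prod_le_revealProb [Fintype V] {β c l₁ : ℝ} (hp₀ : 0 ≤ p) (hp₁ : p ≤ 1)
    (hc₀ : 0 ≤ c) (hc₁ : c * S.weightBound ≤ 1)
    (hexp : ∀ t, 0 ≤ t → t ≤ c * S.weightBound → Real.exp (-(l₁ * t)) ≤ 1 - l * t)
    (hgirth : ∀ (v : V) (c : G.Walk v v), c.IsCycle →
      4 * S.gapBound + b ≤ (b - β) * c.length)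
    {y : G.Dart → ℝ} (hy₀ : ∀ d, 0 ≤ y d) (hy₁ : ∀ d, y d ≤ 1)
    (hy : ∀ d, l₁ * y d ≤ ∑ f ∈ continuations d, y f) (n : ℕ) :
    ∀ (A Y : Finset (Sym2 V)) (U : Set V) (N : Finset G.Dart) (σ : V → S.State), A.card = n →
      Explored G S A Y U N σ →
      1 - ∏ d ∈ N, (1 - c * y d * S.weight (σ d.fst)) ≤
        revealProb p (ContainsFractionOfCircuit G β) A Y := by
  classical
  have hcy : ∀ d s, 0 ≤ c * y d * S.weight s ∧ c * y d * S.weight s ≤ c * S.weightBound := by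
    intro d s
    have h₁ := hy₀ d
    have h₂ := S.weight_nonneg s
    refine ⟨by positivity, ?_⟩
    rw [mul_assoc]
    refine mul_le_mul_of_nonneg_left ?_ hc₀
    calc y d * S.weight s ≤ 1 * S.weight s := mul_le_mul_of_nonneg_right (hy₁ d) h₂
      _ ≤ S.weightBound := by rw [one_mul]; exact S.weight_le s
  have hfac : ∀ d s, 0 ≤ 1 - c * y d * S.weight s := fun d s => by
    have := (hcy d s).2
    linarith
  -- The surplus of `l₁` over `l` pays for replacing a product over the continuations by a linear
  -- bound.
  have hchildren : ∀ d s, ∏ f ∈ continuations d, (1 - c * y f * S.weight s) ≤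
      1 - l * (c * y d * S.weight s) := by
    intro d s
    calc ∏ f ∈ continuations d, (1 - c * y f * S.weight s)
        ≤ ∏ f ∈ continuations d, Real.exp (-(c * y f * S.weight s)) :=
          Finset.prod_le_prod (fun f _ => hfac f s) fun f _ => Real.one_sub_le_exp_neg _
      _ = Real.exp (-(c * S.weight s * ∑ f ∈ continuations d, y f)) := by
          rw [← Real.exp_sum, Finset.sum_neg_distrib, Finset.mul_sum]
          congr 2
          exact Finset.sum_congr rfl fun f _ => by ring
      _ ≤ Real.exp (-(l₁ * (c * y d * S.weight s))) := by
          refine Real.exp_le_exp.2 (neg_le_neg ?_)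
          have := mul_le_mul_of_nonneg_left (hy d) (mul_nonneg hc₀ (S.weight_nonneg s))
          linarith
      _ ≤ _ := hexp _ (hcy d s).1 (hcy d s).2
  induction n with
  | zero =>
    intro A Y U N σ hA h
    have hN : N = ∅ := by
      refine Finset.eq_empty_of_forall_notMem fun d hd => ?_
      have := h.edge_mem d hd
      rw [Finset.card_eq_zero.1 hA] at this
      simp at this
    rw [hN]
    simpa using revealProb_nonneg hp₀ hp₁ A Y
  | succ n ih =>
    intro A Y U N σ hA h
    rcases N.eq_empty_or_nonempty with rfl | ⟨d, hd⟩
    · simpa using revealProb_nonneg hp₀ hp₁ A Y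
    by_cases hdU : d.snd ∈ U
    · rw [revealProb_eq_one (fun s t => ContainsFractionOfCircuit.mono) A
        (h.containsFractionOfCircuit hgirth hd hdU)]
      have := Finset.prod_nonneg (s := N) fun d _ => hfac d (σ d.fst)
      linarith
    have hedge := h.edge_mem d hd
    have hcard : (A.erase d.edge).card = n := by rw [Finset.card_erase_of_mem hedge, hA]; simp
    set R := ∏ f ∈ N.erase d, (1 - c * y f * S.weight (σ f.fst)) with hR
    have hR₀ : 0 ≤ R := Finset.prod_nonneg fun f _ => hfac f _
    have hbound : ∀ (Y' : Finset (Sym2 V)) (s : S.State), Y ⊆ Y' →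
        S.gap (σ d.fst) - ((if d.edge ∈ Y' then 1 else 0) - b) ≤ S.gap s →
        1 - R * (1 - l * (c * y d * S.weight s)) ≤
          revealProb p (ContainsFractionOfCircuit G β) (A.erase d.edge) Y' := by
      intro Y' s hY hs
      refine le_trans ?_ (ih _ _ _ _ _ hcard (h.step hd hdU hY s hs))
      rw [Finset.prod_union]
      · refine sub_le_sub_left (mul_le_mul ?_ ?_ ?_ hR₀) 1
        · refine le_of_eq (Finset.prod_congr rfl fun f hf => ?_)
          have hfU := h.fst_mem f (Finset.mem_of_mem_erase hf)
          rw [Function.update_of_ne fun heq => hdU (by rw [← heq]; exact hfU)]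
        · split_ifs with hw
          · refine le_trans (le_of_eq (Finset.prod_congr rfl fun f hf => ?_)) (hchildren d s)
            have hf' : f.fst = d.snd := by
              simp only [continuations, Finset.mem_filter] at hf
              exact hf.2.1
            rw [hf', Function.update_self]
          · have : S.weight s = 0 := le_antisymm (not_lt.1 hw) (S.weight_nonneg s)
            simp [this]
        · exact Finset.prod_nonneg fun f _ => hfac f _
      · rw [Finset.disjoint_left]
        intro f hf hf'
        split_ifs at hf' with hw
        · simp only [continuations, Finset.mem_filter] at hf'
          exact hdU (hf'.2.1 ▸ h.fst_mem f (Finset.mem_of_mem_erase hf))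
        · simp at hf'
    have hw := h.weight_pos d hd
    have h₁ := hbound (insert d.edge Y) (S.hit (σ d.fst)) (Finset.subset_insert _ _) (by
      rw [if_pos (Finset.mem_insert_self _ _)]
      exact S.gap_hit _ hw)
    -- Nothing excludes `d.edge ∈ Y` here; in that case the required bound on the gap is only
    -- weaker.
    have h₂ := hbound Y (S.miss (σ d.fst)) (Finset.Subset.refl Y) (by
      have := S.gap_miss _ hw
      split_ifs <;> linarith)
    rw [revealProb_erase hedge, ← Finset.mul_prod_erase N _ hd, ← hR]
    have hq : 0 ≤ 1 - p := by linarith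
    refine le_trans ?_ (add_le_add (mul_le_mul_of_nonneg_left h₁ hp₀)
      (mul_le_mul_of_nonneg_left h₂ hq))
    -- Averaging over hit and miss, the factor `l` from `hchildren` cancels the loss of expected
    -- weight.
    have hstep := mul_le_mul_of_nonneg_left (S.weight_le_step (σ d.fst))
      (mul_nonneg hR₀ (mul_nonneg hc₀ (hy₀ d)))
    linarith

lemma explored_init [Fintype V] [DecidableEq V] [DecidableRel G.Adj] (d : G.Dart) :
    Explored G S G.edgeFinset ∅ {d.fst} {d} (fun _ => S.init) := by
  refine ⟨?_, by simp, by simp, by simp [S.weight_init], ?_⟩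
  · intro e he heA
    exact absurd (SimpleGraph.mem_edgeFinset.2 he) heA
  · rintro u rfl v rfl
    refine ⟨.nil, .nil, by simp, by simp, ?_⟩
    have := abs_le.1 (S.abs_gap_le S.init)
    have h0 : (0 : ℝ) ≤ hits ∅ (SimpleGraph.Walk.nil : G.Walk d.fst d.fst) := by positivity
    simp only [SimpleGraph.Walk.length_nil]
    push_cast
    linarith

end Exploration

/-! ### Growing functions from the nonbacktracking radius -/

section Spectral

/-- A nonnegative function on the arcs, normalised to have maximum `1`, that the nonbacktracking
matrix multiplies by `l` at least. -/
structure IsGrowing {V : Type*} [Fintype V] (G : SimpleGraph V) (l : ℝ) (y : G.Dart → ℝ) :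
    Prop where
  nonneg : ∀ d, 0 ≤ y d
  le_one : ∀ d, y d ≤ 1
  exists_eq_one : ∃ d, y d = 1
  le_sum : ∀ d, l * y d ≤ ∑ f ∈ continuations d, y f

/-- Take absolute values of an eigenvector whose eigenvalue exceeds `l` in modulus and apply the
triangle inequality; Perron–Frobenius theory is not needed. -/
lemma exists_isGrowing {V : Type*} [Fintype V] (G : SimpleGraph V) {l : ℝ}
    (hl₀ : 0 ≤ l) (hl : l < nonBacktrackingRadius G) : ∃ y, IsGrowing G l y := by
  classical
  set M := (nonBacktrackingMatrix G).map (fun x : ℝ => (x : ℂ)) with hM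
  have hlt : ENNReal.ofReal l < spectralRadius ℂ M := by
    have hr : l < (spectralRadius ℂ M).toReal := by
      simpa only [nonBacktrackingRadius, hM] using hl
    -- An infinite spectral radius would have `toReal` equal to `0`, contradicting `0 ≤ l`.
    exact (ENNReal.ofReal_lt_iff_lt_toReal hl₀
      fun h => by rw [h] at hr; simp at hr; linarith).2 hr
  rw [spectralRadius] at hlt
  simp only [lt_iSup_iff] at hlt
  obtain ⟨k, hk, hlk⟩ := hlt
  have hlk' : l < ‖k‖ := by
    change _ < ‖k‖ₑ at hlk
    rw [← ofReal_norm] at hlk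
    exact (ENNReal.ofReal_lt_ofReal_iff_of_nonneg hl₀).1 hlk
  rw [spectrum.mem_iff, Matrix.isUnit_iff_isUnit_det, isUnit_iff_ne_zero, not_not,
    ← Matrix.exists_mulVec_eq_zero_iff] at hk
  obtain ⟨z, hz₀, hz⟩ := hk
  have hz' : ∀ d, k * z d = ∑ f ∈ continuations d, z f := by
    intro d
    have h := congrFun hz d
    rw [Matrix.sub_mulVec, Pi.sub_apply, Pi.zero_apply, sub_eq_zero] at h
    have h₁ : ((algebraMap ℂ (Matrix G.Dart G.Dart ℂ)) k).mulVec z d = k * z d := by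
      rw [Algebra.algebraMap_eq_smul_one, Matrix.smul_mulVec, Matrix.one_mulVec, Pi.smul_apply,
        smul_eq_mul]
    rw [← h₁, h, Matrix.mulVec, dotProduct, continuations, Finset.sum_filter]
    refine Finset.sum_congr rfl fun f _ => ?_
    simp only [hM, nonBacktrackingMatrix, Matrix.map_apply, Matrix.of_apply]
    split_ifs <;> simp
  obtain ⟨d₀, hd₀⟩ := Function.ne_iff.1 hz₀
  have : Nonempty G.Dart := ⟨d₀⟩
  obtain ⟨m, hm⟩ := Finite.exists_max fun d => ‖z d‖
  have hmpos : 0 < ‖z m‖ := (norm_pos_iff.2 hd₀).trans_le (hm d₀)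
  refine ⟨fun d => ‖z d‖ / ‖z m‖, fun d => by positivity, fun d => (div_le_one hmpos).2 (hm d),
    ⟨m, div_self hmpos.ne'⟩, fun d => ?_⟩
  rw [← Finset.sum_div, ← mul_div_assoc]
  refine div_le_div_of_nonneg_right ?_ hmpos.le
  calc l * ‖z d‖ ≤ ‖k‖ * ‖z d‖ := mul_le_mul_of_nonneg_right hlk'.le (norm_nonneg _)
    _ = ‖∑ f ∈ continuations d, z f‖ := by rw [← norm_mul, hz']
    _ ≤ _ := norm_sum_le _ _

/-- Extension by zero: the larger graph only adds nonnegative terms to the sums. This carries `y`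
from the core to `G`. -/
lemma IsGrowing.map {V W : Type*} [Fintype V] [Fintype W] {G : SimpleGraph V}
    {H : SimpleGraph W} {l : ℝ} {y : H.Dart → ℝ} (hy : IsGrowing H l y)
    (f : H →g G) (hf : Function.Injective f) : ∃ y', IsGrowing G l y' := by
  classical
  have hinj : Function.Injective f.mapDart := by
    intro d e hde
    have h := congrArg SimpleGraph.Dart.toProd hde
    exact SimpleGraph.Dart.ext _ _ (Function.Injective.prodMap hf hf h)
  refine ⟨Function.extend f.mapDart y 0, ?_, ?_, ?_, ?_⟩
  · intro d
    by_cases hd : ∃ e, f.mapDart e = d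
    · obtain ⟨e, rfl⟩ := hd
      rw [hinj.extend_apply]
      exact hy.nonneg e
    · rw [Function.extend_apply' _ _ _ hd]
      exact le_rfl
  · intro d
    by_cases hd : ∃ e, f.mapDart e = d
    · obtain ⟨e, rfl⟩ := hd
      rw [hinj.extend_apply]
      exact hy.le_one e
    · rw [Function.extend_apply' _ _ _ hd]
      exact zero_le_one
  · obtain ⟨e, he⟩ := hy.exists_eq_one
    exact ⟨f.mapDart e, by rw [hinj.extend_apply, he]⟩
  · have hnn : ∀ d, 0 ≤ Function.extend f.mapDart y 0 d := by
      intro d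
      by_cases hd : ∃ e, f.mapDart e = d
      · obtain ⟨e, rfl⟩ := hd
        rw [hinj.extend_apply]
        exact hy.nonneg e
      · rw [Function.extend_apply' _ _ _ hd]
        exact le_rfl
    intro d
    by_cases hd : ∃ e, f.mapDart e = d
    · obtain ⟨e, rfl⟩ := hd
      rw [hinj.extend_apply]
      refine (hy.le_sum e).trans ?_
      calc ∑ g ∈ continuations e, y g
          = ∑ g ∈ (continuations e).map ⟨f.mapDart, hinj⟩,
              Function.extend f.mapDart y 0 g := by
            rw [Finset.sum_map]
            exact Finset.sum_congr rfl fun g _ => (hinj.extend_apply y 0 g).symm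
        _ ≤ _ := by
            refine Finset.sum_le_sum_of_subset_of_nonneg ?_ fun g _ _ => hnn g
            intro g hg
            obtain ⟨g', hg', rfl⟩ := Finset.mem_map.1 hg
            have hg₁ : g'.fst = e.snd ∧ e.fst ≠ g'.snd := by simpa [continuations] using hg'
            refine Finset.mem_filter.2 ⟨Finset.mem_univ _, congrArg f hg₁.1, fun h => hg₁.2 (hf h)⟩
    · rw [Function.extend_apply' _ _ _ hd]
      simpa using Finset.sum_nonneg fun g _ => hnn g

/-- Beyond a certain number of vertices, the graphs in the class have radius at least some number
larger than `x`. -/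
lemma exists_le_nonBacktrackingRadius {μ x : ℝ} (hx : x < lambdaStar μ) :
    ∃ l, x < l ∧ ∃ n₀ : ℕ, ∀ n ≥ n₀, ∀ G : SimpleGraph (Fin n), InClass μ G →
      l ≤ nonBacktrackingRadius G := by
  have hnn : ∀ n, ∀ r ∈ {r : ℝ | ∃ G : SimpleGraph (Fin n), InClass μ G ∧
      nonBacktrackingRadius G = r}, 0 ≤ r := by
    rintro n r ⟨G, -, rfl⟩
    exact ENNReal.toReal_nonneg
  rw [lambdaStar, Filter.liminf_eq] at hx
  obtain ⟨l, hl, hxl⟩ := exists_lt_of_lt_csSup (α := ℝ)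
    ⟨0, Filter.Eventually.of_forall fun n => Real.sInf_nonneg (hnn n)⟩ hx
  obtain ⟨n₀, hn₀⟩ := Filter.eventually_atTop.1 hl
  refine ⟨l, hxl, n₀, fun n hn G hG => (hn₀ n hn).trans ?_⟩
  exact csInf_le ⟨0, hnn n⟩ ⟨G, hG, rfl⟩

end Spectral

/-! ### Reduction to minimum degree two -/

section Core

lemma avgDegree_eq {V : Type*} [Fintype V] (G : SimpleGraph V) [Fintype G.edgeSet] :
    avgDegree G = 2 * (G.edgeFinset.card : ℝ) / Fintype.card V := by
  classical
  rw [avgDegree]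
  congr 1
  have h := G.sum_degrees_eq_twice_card_edges
  have h' : ∑ v, (G.degree v : ℝ) = ((∑ v, G.degree v : ℕ) : ℝ) := by push_cast; rfl
  convert (h'.trans (congrArg Nat.cast h)) using 1
  push_cast
  congr!

lemma InClass.map_iso {V W : Type*} [Fintype V] [Fintype W] {G : SimpleGraph V}
    {H : SimpleGraph W} (e : G ≃g H) {μ : ℝ} (h : InClass μ G) : InClass μ H := by
  classical
  obtain ⟨h₁, h₂, h₃⟩ := h
  refine ⟨e.connected_iff.1 h₁, ?_, ?_⟩
  · rw [avgDegree_eq] at h₂ ⊢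
    rwa [← e.card_edgeFinset_eq, ← Fintype.card_congr e.toEquiv]
  · intro w
    have := h₃ (e.symm w)
    rw [← e.symm.degree_eq w]
    convert this

/-- A connected graph whose average degree is at least `μ ≥ 2` contains a subgraph of minimum
degree at least `2` with these properties. -/
lemma exists_core {μ : ℝ} (hμ : 2 ≤ μ) (n : ℕ) :
    ∀ (V : Type*) [Fintype V] (G : SimpleGraph V), Fintype.card V = n → G.Connected →
      μ ≤ avgDegree G → ∃ (m : ℕ) (K : SimpleGraph (Fin m)) (f : K →g G),
        Function.Injective f ∧ InClass μ K := by
  classical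
  induction n with
  | zero =>
    intro V _ G hV hG
    have := hG.nonempty
    exact absurd hV Fintype.card_ne_zero
  | succ n ih =>
    intro V _ G hV hG havg
    by_cases hdeg : ∀ v, 2 ≤ G.degree v
    · refine ⟨_, G.overFin rfl, (G.overFinIso rfl).symm.toHom,
        (G.overFinIso rfl).symm.injective, ?_⟩
      exact InClass.map_iso (G.overFinIso rfl) ⟨hG, havg, fun v => by convert hdeg v⟩
    · push Not at hdeg
      obtain ⟨v, hv⟩ := hdeg
      have hcardV : (0 : ℝ) < Fintype.card V := by rw [hV]; positivity
      have havg' := havg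
      rw [avgDegree_eq, le_div_iff₀ hcardV] at havg'
      have hnt : Nontrivial V := by
        by_contra hnt
        rw [not_nontrivial_iff_subsingleton] at hnt
        have hE : G.edgeFinset = ∅ := by
          rw [SimpleGraph.edgeFinset_eq_empty]
          ext a b
          simp [Subsingleton.elim a b]
        rw [hE] at havg'
        simp at havg'
        nlinarith
      have hpos := hG.preconnected.degree_pos_of_nontrivial v
      have hone : G.degree v = 1 := by omega
      have hconn := hG.induce_compl_singleton_of_degree_eq_one hone
      have hcard : Fintype.card ({v}ᶜ : Set V) = n := by
        rw [Fintype.card_compl_set, hV]; simp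
      have hE := (G.card_edgeFinset_induce_compl_singleton v).trans
        (G.card_edgeFinset_deleteIncidenceSet v)
      have hEle := G.degree_le_card_edgeFinset v
      have hn : 0 < n := by
        have := Fintype.one_lt_card (α := V)
        omega
      have hn' : (0 : ℝ) < n := by exact_mod_cast hn
      -- Deleting a leaf lowers `2|E|` by `2` and `μ|V|` by `μ ≥ 2`, so `2|E| ≥ μ|V|` persists.
      obtain ⟨m, K, f, hf, hK⟩ := ih _ (G.induce ({v}ᶜ : Set V)) hcard hconn (by
        rw [avgDegree_eq, hcard, le_div_iff₀ hn']
        have hE' : ((G.induce ({v}ᶜ : Set V)).edgeFinset.card : ℝ) + 1 = G.edgeFinset.card := by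
          rw [hone] at hE hEle
          have : (G.induce ({v}ᶜ : Set V)).edgeFinset.card + 1 = G.edgeFinset.card := by
            rw [hE]; omega
          exact_mod_cast this
        rw [hV] at havg'
        push_cast at havg'
        linarith)
      exact ⟨m, K, (SimpleGraph.Embedding.induce _).toHom.comp f,
        Subtype.val_injective.comp hf, hK⟩

lemma InClass.exists_isCycle {V : Type*} [Fintype V] {G : SimpleGraph V} {μ : ℝ}
    (h : InClass μ G) : ∃ (v : V) (c : G.Walk v v), c.IsCycle := by
  classical
  by_contra hcon
  push Not at hcon
  have htree : G.IsTree := ⟨h.1, fun v c => hcon v c⟩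
  obtain ⟨v₀⟩ := h.1.nonempty
  have hnt : Nontrivial V := by
    by_contra hnt
    rw [not_nontrivial_iff_subsingleton] at hnt
    have h₂ := h.2.2 v₀
    have hlt := G.degree_lt_card_verts v₀
    have := Fintype.card_le_one_iff_subsingleton.2 hnt
    have h₂' : 2 ≤ G.degree v₀ := by convert h₂
    omega
  obtain ⟨v, hv⟩ := htree.exists_vert_degree_one_of_nontrivial
  have h₂ : 2 ≤ G.degree v := by convert h.2.2 v
  omega

lemma length_le_card_of_isCycle {V : Type*} [Fintype V] {G : SimpleGraph V} {v : V}
    {c : G.Walk v v} (hc : c.IsCycle) : c.length ≤ Fintype.card V := by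
  have h := hc.support_nodup.length_le_card
  simpa using h

end Core

/-! ### Assembling the uniform bound -/

lemma exists_exp_neg_le {l l₁ : ℝ} (hl : 0 < l) (hl₁ : l < l₁) :
    ∃ ε, 0 < ε ∧ ∀ t, 0 ≤ t → t ≤ ε → Real.exp (-(l₁ * t)) ≤ 1 - l * t := by
  have hl₁₀ : 0 < l₁ := hl.trans hl₁
  -- With `exp (-(l₁ * t)) ≤ 1 / (1 + l₁ * t)` it suffices that `1 ≤ (1 - l * t) * (1 + l₁ * t)`,
  -- which for `t > 0` means `l₁ * l * t ≤ l₁ - l`.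
  refine ⟨(l₁ - l) / (l₁ * l), div_pos (by linarith) (by positivity), fun t ht₀ ht => ?_⟩
  have h₁ : 1 + l₁ * t ≤ Real.exp (l₁ * t) := by linarith [Real.add_one_le_exp (l₁ * t)]
  have hpos : 0 < 1 + l₁ * t := by positivity
  rw [le_div_iff₀ (by positivity)] at ht
  rw [Real.exp_neg]
  refine (inv_anti₀ hpos h₁).trans ?_
  rw [inv_le_iff_one_le_mul₀ hpos]
  nlinarith [mul_nonneg ht₀ (sub_nonneg.2 ht)]

lemma pow_length_le_circuitProb {V : Type*} [Fintype V] {G : SimpleGraph V} (p : unitInterval)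
    {β : ℝ} (hβ : β ≤ 1) {v : V} {c : G.Walk v v} (hc : c.IsCycle) :
    (p : ℝ) ^ c.length ≤ circuitProb p β G := by
  classical
  rw [circuitProb_eq_revealProb]
  have hnd := hc.isTrail.edges_nodup
  have hcard : c.edges.toFinset.card = c.length := by
    rw [List.toFinset_card_of_nodup hnd, SimpleGraph.Walk.length_edges]
  rw [← hcard]
  refine pow_card_le_revealProb p.2.1 p.2.2 (fun s t => ContainsFractionOfCircuit.mono) _ _ _ ?_ ?_
  · intro e he
    exact SimpleGraph.mem_edgeFinset.2 (c.edges_subset_edgeSet (by simpa using he))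
  · refine ⟨v, c, hc, ?_⟩
    have hset : ((c.edges.toFinset : Set (Sym2 V)) ∪ ((∅ : Finset (Sym2 V)) : Set (Sym2 V))) ∩
        {e | e ∈ c.edges} = c.edges.toFinset := by
      ext e; simp
    rw [hset, Set.ncard_coe_finset, hcard]
    nlinarith [(Nat.cast_nonneg c.length : (0 : ℝ) ≤ c.length)]

/-- A graph of large girth carrying a growing function on its arcs contains a circuit with many
edges of a random set, with probability bounded from below. -/
lemma IsGrowing.le_circuitProb {V : Type*} [Fintype V] {G : SimpleGraph V} {p : unitInterval}
    {β b l l₁ ε : ℝ} (S : ScoreProcess p l b) (hε : 0 < ε) (hε₁ : ε ≤ 1)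
    (hexp : ∀ t, 0 ≤ t → t ≤ ε → Real.exp (-(l₁ * t)) ≤ 1 - l * t)
    (hgirth : ∀ (v : V) (c : G.Walk v v), c.IsCycle →
      4 * S.gapBound + b ≤ (b - β) * c.length)
    {y : G.Dart → ℝ} (hy : IsGrowing G l₁ y) :
    ε / S.weightBound * S.weight S.init ≤ circuitProb p β G := by
  classical
  have hH : 0 < S.weightBound := S.weight_init.trans_le (S.weight_le _)
  have hcH : ε / S.weightBound * S.weightBound = ε := by field_simp
  obtain ⟨d, hd⟩ := hy.exists_eq_one
  have h := one_sub_prod_le_revealProb (c := ε / S.weightBound) p.2.1 p.2.2 (by positivity)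
    (by rw [hcH]; exact hε₁) (by rw [hcH]; exact hexp) hgirth hy.nonneg hy.le_one hy.le_sum _
    _ _ _ _ _ rfl (explored_init (S := S) d)
  rw [circuitProb_eq_revealProb]
  rw [Finset.prod_singleton, hd] at h
  refine le_trans (by linarith) (h.trans (le_of_eq ?_))
  congr!

end CycleCode

theorem mainTheorem4 (μ₀ : ℝ) (hμ₀ : 2 ≤ μ₀) (p β : unitInterval)
    (hp : 0 < (p : ℝ)) (hpβ : (p : ℝ) < (β : ℝ)) (hβ : (β : ℝ) < 1)
    (hD : Real.exp (CycleCode.relEntropy (β : ℝ) (p : ℝ)) < CycleCode.lambdaStar μ₀) :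
    ∃ δ : ℝ, 0 < δ ∧
      ∀ (V : Type*) [Fintype V] (G : SimpleGraph V), G.Connected →
        μ₀ ≤ CycleCode.avgDegree G → δ ≤ CycleCode.circuitProb p (β : ℝ) G := by
  -- Three rates above `exp D`: `l` for the automaton, `l₁` for the growing function, `l₂` for the
  -- radius. The gap `l < l₁` makes `ε` positive; `l₁ < l₂` provides the strict inequality
  -- `exists_isGrowing` needs.
  obtain ⟨l₂, hl₂, n₀, hn₀⟩ := CycleCode.exists_le_nonBacktrackingRadius hD
  obtain ⟨l₁, hDl₁, hl₁₂⟩ := exists_between hl₂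
  obtain ⟨l, hDl, hl₁⟩ := exists_between hDl₁
  have hl₀ : 0 < l := (Real.exp_pos _).trans hDl
  obtain ⟨b, hβb, ⟨S⟩⟩ := CycleCode.exists_scoreProcess hp hpβ hβ hDl
  obtain ⟨ε, hε, hexp⟩ := CycleCode.exists_exp_neg_le hl₀ hl₁
  obtain ⟨g, hg⟩ := exists_nat_ge ((4 * S.gapBound + b) / (b - β))
  have hbβ : 0 < b - β := sub_pos.2 hβb
  have hH : 0 < S.weightBound := S.weight_init.trans_le (S.weight_le _)
  -- Girth at least `g` absorbs the bounded error in hits; girth at least `n₀` forces the core to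
  -- have `n₀` vertices.
  refine ⟨min ((p : ℝ) ^ (g + n₀)) (min ε 1 / S.weightBound * S.weight S.init), ?_, ?_⟩
  · have := S.weight_init
    have : 0 < min ε 1 := lt_min hε one_pos
    positivity
  intro V _ G hG hμ
  by_cases hgirth : ∃ (v : V) (c : G.Walk v v), c.IsCycle ∧ c.length < g + n₀
  · obtain ⟨v, c, hc, hlen⟩ := hgirth
    refine (min_le_left _ _).trans ((pow_le_pow_of_le_one p.2.1 p.2.2 hlen.le).trans ?_)
    exact CycleCode.pow_length_le_circuitProb p hβ.le hc
  · push Not at hgirth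
    refine (min_le_right _ _).trans ?_
    obtain ⟨m, K, f, hf, hK⟩ := CycleCode.exists_core hμ₀ _ V G rfl hG hμ
    obtain ⟨v, c, hc⟩ := hK.exists_isCycle
    have hm : n₀ ≤ m := by
      have h₁ := CycleCode.length_le_card_of_isCycle hc
      have h₂ := hgirth _ _ (hc.map (f := f) hf)
      rw [SimpleGraph.Walk.length_map] at h₂
      rw [Fintype.card_fin] at h₁
      omega
    obtain ⟨y, hy⟩ := CycleCode.exists_isGrowing K (hl₀.trans hl₁).le
      (hl₁₂.trans_le (hn₀ m hm K hK))
    obtain ⟨y', hy'⟩ := hy.map f hf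
    refine hy'.le_circuitProb S (lt_min hε one_pos) (min_le_right _ _)
      (fun t ht₀ ht => hexp t ht₀ (ht.trans (min_le_left _ _))) fun v c hc => ?_
    have h : (g : ℝ) ≤ c.length := by
      have := hgirth v c hc
      exact_mod_cast (by omega : g ≤ c.length)
    rw [div_le_iff₀ hbβ] at hg
    nlinarith
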